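/- Fix a natural number $n\ge 3$. Language. Consider models $$\mathfrak M=\langle B,Q;\mathsf{Ob},\mathsf{IOb},\mathsf{Ph},+,\cdot,\le,\mathsf W\rangle,$$ where $B$ (bodies) and $Q$ (quantities) are nonempty sets; $\mathsf{Ob},\mathsf{IOb},\mathsf{Ph}\subseteq B$ are the sets of observers, inertial observers and light signals; $+,\cdot$ are binary operations and $\le$ is a binary relation on $Q$; and $\mathsf W\subseteq B\times B\times Q^n$ is the worldview relation ($\mathsf W(m,b,\bar x)$: "$m$ coordinatizes $b$ at $\bar x$"). The quantity part of $\mathfrak M$ is $\langle Q,+,\cdot,\le\rangle$. For $\bar x,\bar y\in Q^n$ put $\mathsf{time}(\bar x,\bar y)=x_1-y_1$, $\mathsf{space}^2(\bar x,\bar y)=\sum_{i=2}^n (x_i-y_i)^2$, and $\mathsf{ev}_m(\bar x)=\{b\in B:\mathsf W(m,b,\bar x)\}$. Axioms. - $\mathsf{AxOField}$: $\langle Q,+,\cdot\rangle$ is a field and $\le$ is a linear order on $Q$ such that $x\le y$ implies $x+z\le y+z$, and $0\le x$, $0\le y$ imply $0\le xy$. - $\mathsf{AxPh}$: for every $m\in\mathsf{IOb}$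 there is $c_m>0$ such that for all $\bar x,\bar y\in Q^n$: there is $p\in\mathsf{Ph}$ with $\mathsf W(m,p,\bar x)$ and $\mathsf W(m,p,\bar y)$ if and only if $\mathsf{space}^2(\bar x,\bar y)=c_m^2\cdot\mathsf{time}(\bar x,\bar y)^2$. (This $c_m$ is unique; it is the speed of light according to $m$.) - $\mathsf{AxEv}$: for all $m,k\in\mathsf{IOb}$ and $\bar x\in Q^n$ there is $\bar y\in Q^n$ with $\mathsf{ev}_m(\bar x)=\mathsf{ev}_k(\bar y)$. - $\mathsf{AxSelf}$: for all $m\in\mathsf{IOb}$ and $\bar x\in Q^n$: $\mathsf W(m,m,\bar x)$ if and only if $x_2=\dots=x_n=0$. - $\mathsf{AxSymD}$: for all $m,k\in\mathsf{IOb}$ and $\bar x,\bar y,\bar x',\bar y'\in Q^n$, if $x_1=y_1$, $x_1'=y_1'$, $\mathsf{ev}_m(\bar x)=\mathsf{ev}_k(\bar x')$ and $\mathsf{ev}_m(\bar y)=\mathsf{ev}_k(\bar y')$, then $\mathsf{space}^2(\bar x,\bar y)=\mathsf{space}^2(\bar x',\bar y')$; moreover, for every $m\in\mathsf{IOb}$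 there is $p\in\mathsf{Ph}$ with $\mathsf W(m,p,0,\dots,0)$ and $\mathsf W(m,p,1,1,0,\dots,0)$. - $\mathsf{AxThExp}$: $\mathsf{IOb}\neq\emptyset$, and for all $m\in\mathsf{IOb}$ and $\bar x,\bar y\in Q^n$ with $\mathsf{space}^2(\bar x,\bar y)<c_m^2\cdot\mathsf{time}(\bar x,\bar y)^2$ there is $k\in\mathsf{IOb}$ with $\mathsf W(m,k,\bar x)$ and $\mathsf W(m,k,\bar y)$. Let $\mathsf{SpecRel}=\{\mathsf{AxOField},\mathsf{AxPh},\mathsf{AxEv},\mathsf{AxSelf},\mathsf{AxSymD}\}$, and let $\mathit{Num}_n(\mathsf{SpecRel}+\mathsf{AxThExp})$ be the class of the quantity parts $\langle Q,+,\cdot,\le\rangle$ of all such models that satisfy $\mathsf{SpecRel}$ and $\mathsf{AxThExp}$. A Euclidean field is an ordered field in which every positive element has a square root. Theorem. For every $n\ge 3$, $$\mathit{Num}_n(\mathsf{SpecRel}+\mathsf{AxThExp})=\{\text{Euclidean fields}\}.$$ -/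

import Mathlib

universe u

namespace Spacetime

/-- A structure `⟨Q, +, ·, ≤⟩`: a nonempty set with two binary operations and a binary relation,
on which no axioms are imposed. -/
structure QuantityStructure : Type (u + 1) where
  carrier : Type u
  nonempty : Nonempty carrier
  add : carrier → carrier → carrier
  mul : carrier → carrier → carrier
  le : carrier → carrier → Prop

instance : CoeSort QuantityStructure.{u} (Type u) := ⟨QuantityStructure.carrier⟩

/-- `⟨Q, +, ·⟩` is a field, `≤` is a linear order on `Q`, and the order is compatible with the
operations. The neutral elements `0` (here `z`) and `1` (here `e`) are not part of the language. -/
class IsOrderedField (A : QuantityStructure.{u}) : Prop where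
  add_assoc : ∀ a b c : A, A.add (A.add a b) c = A.add a (A.add b c)
  add_comm : ∀ a b : A, A.add a b = A.add b a
  mul_assoc : ∀ a b c : A, A.mul (A.mul a b) c = A.mul a (A.mul b c)
  mul_comm : ∀ a b : A, A.mul a b = A.mul b a
  mul_add : ∀ a b c : A, A.mul a (A.add b c) = A.add (A.mul a b) (A.mul a c)
  exists_neutral : ∃ z e : A, e ≠ z ∧
    (∀ a, A.add a z = a) ∧ (∀ a, ∃ b, A.add a b = z) ∧
    (∀ a, A.mul a e = a) ∧ (∀ a, a ≠ z → ∃ b, A.mul a b = e)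
  le_refl : ∀ a : A, A.le a a
  le_trans : ∀ a b c : A, A.le a b → A.le b c → A.le a c
  le_antisymm : ∀ a b : A, A.le a b → A.le b a → a = b
  le_total : ∀ a b : A, A.le a b ∨ A.le b a
  add_le_add_right : ∀ a b c : A, A.le a b → A.le (A.add a c) (A.add b c)
  mul_nonneg : ∀ z : A, (∀ a, A.add a z = a) →
    ∀ a b : A, A.le z a → A.le z b → A.le z (A.mul a b)

section OrderedField

variable (A : QuantityStructure.{u}) [IsOrderedField A]

/-- The zero element of an ordered field in the language `+, ·, ≤`. -/
noncomputable def zeroElt : A := (IsOrderedField.exists_neutral (A := A)).choose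

/-- The unit element of an ordered field in the language `+, ·, ≤`. -/
noncomputable def oneElt : A := (IsOrderedField.exists_neutral (A := A)).choose_spec.choose

theorem neutral_spec : oneElt A ≠ zeroElt A ∧
    (∀ a, A.add a (zeroElt A) = a) ∧ (∀ a, ∃ b, A.add a b = zeroElt A) ∧
    (∀ a, A.mul a (oneElt A) = a) ∧ (∀ a, a ≠ zeroElt A → ∃ b, A.mul a b = oneElt A) :=
  (IsOrderedField.exists_neutral (A := A)).choose_spec.choose_spec

theorem exists_inv (a : A) :
    ∃ b, (a ≠ zeroElt A → A.mul a b = oneElt A) ∧ (a = zeroElt A → b = zeroElt A) := by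
  by_cases h : a = zeroElt A
  · exact ⟨zeroElt A, fun h' => absurd h h', fun _ => rfl⟩
  · obtain ⟨b, hb⟩ := (neutral_spec A).2.2.2.2 a h
    exact ⟨b, fun _ => hb, fun h' => absurd h' h⟩

/-- The commutative ring given by the operations `A.add` and `A.mul`. -/
noncomputable instance instCommRing : CommRing A where
  add := A.add
  mul := A.mul
  zero := zeroElt A
  one := oneElt A
  neg a := ((neutral_spec A).2.2.1 a).choose
  add_assoc := IsOrderedField.add_assoc
  add_comm := IsOrderedField.add_comm
  zero_add a := (IsOrderedField.add_comm _ a).trans ((neutral_spec A).2.1 a)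
  add_zero := (neutral_spec A).2.1
  neg_add_cancel a :=
    (IsOrderedField.add_comm _ a).trans ((neutral_spec A).2.2.1 a).choose_spec
  nsmul := @nsmulRec _ ⟨zeroElt A⟩ ⟨A.add⟩
  zsmul := @zsmulRec _ ⟨zeroElt A⟩ ⟨A.add⟩ ⟨fun a => ((neutral_spec A).2.2.1 a).choose⟩
    (@nsmulRec _ ⟨zeroElt A⟩ ⟨A.add⟩)
  mul_assoc := IsOrderedField.mul_assoc
  mul_comm := IsOrderedField.mul_comm
  one_mul a := (IsOrderedField.mul_comm _ a).trans ((neutral_spec A).2.2.2.1 a)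
  mul_one := (neutral_spec A).2.2.2.1
  left_distrib := IsOrderedField.mul_add
  right_distrib a b c := by
    change A.mul (A.add a b) c = A.add (A.mul a c) (A.mul b c)
    rw [IsOrderedField.mul_comm, IsOrderedField.mul_add, IsOrderedField.mul_comm c a,
      IsOrderedField.mul_comm c b]
  zero_mul a := by
    change A.mul (zeroElt A) a = zeroElt A
    have h : A.add (A.mul a (zeroElt A)) (A.mul a (zeroElt A)) = A.mul a (zeroElt A) := by
      rw [← IsOrderedField.mul_add, (neutral_spec A).2.1]
    obtain ⟨b, hb⟩ := (neutral_spec A).2.2.1 (A.mul a (zeroElt A))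
    have h2 := congrArg (fun t => A.add t b) h
    simp only [IsOrderedField.add_assoc, hb, (neutral_spec A).2.1] at h2
    rw [IsOrderedField.mul_comm, h2]
  mul_zero a := by
    change A.mul a (zeroElt A) = zeroElt A
    have h : A.add (A.mul a (zeroElt A)) (A.mul a (zeroElt A)) = A.mul a (zeroElt A) := by
      rw [← IsOrderedField.mul_add, (neutral_spec A).2.1]
    obtain ⟨b, hb⟩ := (neutral_spec A).2.2.1 (A.mul a (zeroElt A))
    have h2 := congrArg (fun t => A.add t b) h
    simpa only [IsOrderedField.add_assoc, hb, (neutral_spec A).2.1] using h2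

/-- The field given by the operations `A.add` and `A.mul`. -/
noncomputable instance instField : Field A where
  __ := instCommRing A
  inv a := (exists_inv A a).choose
  exists_pair_ne := ⟨oneElt A, zeroElt A, (neutral_spec A).1⟩
  mul_inv_cancel a h := (exists_inv A a).choose_spec.1 h
  inv_zero := (exists_inv A (zeroElt A)).choose_spec.2 rfl
  nnqsmul := _
  qsmul := _

/-- The linear order given by `A.le`. -/
noncomputable instance instLinearOrder : LinearOrder A where
  le := A.le
  le_refl := IsOrderedField.le_refl
  le_trans := IsOrderedField.le_trans
  le_antisymm := IsOrderedField.le_antisymm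
  le_total := IsOrderedField.le_total
  toDecidableLE := Classical.decRel _

instance instIsStrictOrderedRing : IsStrictOrderedRing A := by
  have : IsOrderedAddMonoid A :=
    { add_le_add_left := fun a b h c => IsOrderedField.add_le_add_right a b c h }
  have hmul : ∀ a b : A, 0 ≤ a → 0 ≤ b → 0 ≤ a * b := fun a b ha hb =>
    IsOrderedField.mul_nonneg (zeroElt A) (neutral_spec A).2.1 a b ha hb
  have : ZeroLEOneClass A := ⟨by
    rcases le_total (0 : A) 1 with h | h
    · exact h
    · have h1 : (0 : A) ≤ -1 := by simpa using h
      simpa using hmul (-1) (-1) h1 h1⟩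
  exact IsStrictOrderedRing.of_mul_pos fun a b ha hb =>
    lt_of_le_of_ne (hmul a b ha.le hb.le) (mul_ne_zero ha.ne' hb.ne').symm

theorem add_def (a b : A) : a + b = A.add a b := rfl

theorem mul_def (a b : A) : a * b = A.mul a b := rfl

theorem le_def (a b : A) : a ≤ b ↔ A.le a b := Iff.rfl

end OrderedField

/-- A Euclidean field: an ordered field in which every positive element is a square. -/
class IsEuclideanField (A : QuantityStructure.{u}) : Prop extends IsOrderedField A where
  exists_sqrt : ∀ a : A, 0 < a → ∃ b : A, b * b = a

/-- Models of the two-sorted language `{B, Q; Ob, IOb, Ph, +, ·, ≤, W}` for spacetime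
dimension `d`. `W m b x` says that `m` coordinatizes the body `b` at the spacetime location `x`;
the coordinate `x 0` is the time and the other coordinates are spatial. -/
structure Model (d : ℕ) : Type (u + 1) where
  /-- quantities -/
  Q : QuantityStructure.{u}
  /-- bodies -/
  B : Type u
  nonempty_bodies : Nonempty B
  /-- observers -/
  Ob : B → Prop
  /-- inertial observers -/
  IOb : B → Prop
  /-- light signals -/
  Ph : B → Prop
  /-- the worldview relation -/
  W : B → B → (Fin d → Q) → Prop

section Coordinates

variable {d : ℕ} [NeZero d] {F : Type u} [Field F]

/-- The time difference of two coordinate points. -/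
def time (x y : Fin d → F) : F := x 0 - y 0

/-- The squared spatial distance of two coordinate points. -/
def space2 (x y : Fin d → F) : F := ∑ i : Fin d with i ≠ 0, (x i - y i) ^ 2

end Coordinates

namespace Model

variable {d : ℕ} [NeZero d] (M : Model.{u} d)

/-- The event occurring for `m` at `x`: the set of bodies that `m` coordinatizes at `x`. -/
def ev (m : M.B) (x : Fin d → M.Q) : Set M.B := {b | M.W m b x}

/-- The quantity part is an ordered field. -/
abbrev AxOField : Prop := IsOrderedField M.Q

/-- For each inertial observer there is a positive speed `c` such that there is a light signal
through two given points if and only if they are connected by a line of speed `c`. -/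
def AxPh [M.AxOField] : Prop :=
  ∀ m, M.IOb m → ∃ c : M.Q, 0 < c ∧ ∀ x y : Fin d → M.Q,
    (∃ p, M.Ph p ∧ M.W m p x ∧ M.W m p y) ↔ space2 x y = c ^ 2 * time x y ^ 2

/-- The relation `c(m, v)`: `v` is the speed of light according to `m`. Given `AxPh`, for every
inertial observer `m` it holds for exactly one `v`, which is denoted `c_m`. -/
def SpeedOfLight [M.AxOField] (m : M.B) (v : M.Q) : Prop :=
  0 < v ∧ ∀ x y : Fin d → M.Q,
    (∃ p, M.Ph p ∧ M.W m p x ∧ M.W m p y) → space2 x y = v ^ 2 * time x y ^ 2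

/-- All inertial observers coordinatize the same set of events. -/
def AxEv : Prop :=
  ∀ m k, M.IOb m → M.IOb k → ∀ x : Fin d → M.Q, ∃ y : Fin d → M.Q, M.ev m x = M.ev k y

/-- Any inertial observer is stationary relative to itself. -/
def AxSelf [M.AxOField] : Prop :=
  ∀ m, M.IOb m → ∀ x : Fin d → M.Q, M.W m m x ↔ ∀ i, i ≠ 0 → x i = 0

/-- Any two inertial observers agree on the spatial distance of two events that are simultaneous
for both of them, and for every inertial observer a light signal passes through the points
`(0, 0, 0, …, 0)` and `(1, 1, 0, …, 0)`. -/
def AxSymD [M.AxOField] : Prop :=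
  (∀ m k, M.IOb m → M.IOb k → ∀ x y x' y' : Fin d → M.Q,
    x 0 = y 0 → x' 0 = y' 0 → M.ev m x = M.ev k x' → M.ev m y = M.ev k y' →
      space2 x y = space2 x' y') ∧
  (∀ m, M.IOb m → ∃ p, M.Ph p ∧ M.W m p (fun _ => 0) ∧
    M.W m p (fun i => if i.val < 2 then 1 else 0))

/-- The axiom system `SpecRel`. -/
class SpecRel : Prop extends M.AxOField where
  axPh : M.AxPh
  axEv : M.AxEv
  axSelf : M.AxSelf
  axSymD : M.AxSymD

/-- There is an inertial observer, and inertial observers can move along any straight line with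
any speed less than the speed of light. -/
def AxThExp [M.AxOField] : Prop :=
  (∃ h, M.IOb h) ∧
  ∀ m, M.IOb m → ∀ c : M.Q, M.SpeedOfLight m c → ∀ x y : Fin d → M.Q,
    space2 x y < c ^ 2 * time x y ^ 2 → ∃ k, M.IOb k ∧ M.W m k x ∧ M.W m k y

/-- The axiom system `SpecRel + AxThExp`. -/
class SpecRelThExp : Prop extends M.SpecRel where
  axThExp : M.AxThExp

end Model

/-- `Num d Th` is the class of the quantity parts of the `d`-dimensional models of `Th`. -/
def Num (d : ℕ) (Th : Model.{u} d → Prop) : Set QuantityStructure.{u} :=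
  {A | ∃ M : Model.{u} d, Th M ∧ M.Q = A}

end Spacetime

/-! For an inertial observer the light signals encode exactly the relation "the difference is
Minkowski-null", because `AxSymD` forces the speed of light to be 1. A point is determined by its
null cone, so two inertial observers are related by a bijection that preserves this relation in both
directions. An Alexandrov–Zeeman argument, valid over any ordered field, makes it additive up to a
translation: null lines go to null lines (`PreservesNull.exists_smul`), null parallelograms go to
parallelograms (`PreservesNull.parallelogram`), and null vectors span.

The additive part `f` need not be linear. On three orthonormal directions it is semilinear with a
scalar map `σ`, it multiplies the standard Gram matrix by a constant, and `σ` preserves squares. Let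
`k` move with velocity `v` along one direction. Then `f` sends `e₀ + v e₁` to the time axis of `k`,
and a transverse unit vector to a vector that is purely spatial for `k`. `AxSymD` makes the Gram
constant 1, and pulling the length of the image back through `σ` shows that `1 - v²` is a square
(`LorentzTriple.isSquare_one_sub_sq`). Since `AxThExp` supplies all subluminal velocities, `v = (a -
1)/(a + 1)` yields a square root of any `a > 0`.

Conversely, over a Euclidean field the Poincaré maps serve as inertial observers and the null lines
as photons. Square roots normalise timelike vectors, and a reflection takes the time unit vector to
any vector of square length 1, which gives `AxThExp`. -/

namespace LinearMap.BilinForm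

/-! ### Bijections that preserve the null relation are additive up to translation. -/

section NullVectors

variable {F V : Type*} [Field F] [AddCommGroup V] [Module F V]
  {B : LinearMap.BilinForm F V}

/-- Orthogonal null vectors are parallel. -/
def NullParallel (B : LinearMap.BilinForm F V) : Prop :=
  ∀ a b : V, a ≠ 0 → B a a = 0 → B b b = 0 → B a b = 0 → ∃ t : F, b = t • a

/-- The bijection `φ` preserves the relation "`x - y` is a null vector" in both directions. -/
def PreservesNull (B : LinearMap.BilinForm F V) (φ : V ≃ V) : Prop :=
  ∀ x y, B (φ x - φ y) (φ x - φ y) = 0 ↔ B (x - y) (x - y) = 0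

theorem PreservesNull.symm {φ : V ≃ V} (hφ : PreservesNull B φ) : PreservesNull B φ.symm := by
  intro x y
  simpa using (hφ (φ.symm x) (φ.symm y)).symm

theorem PreservesNull.null {φ : V ≃ V} (hφ : PreservesNull B φ) (p : V) {a : V}
    (ha : B a a = 0) : B (φ (p + a) - φ p) (φ (p + a) - φ p) = 0 := by
  rw [hφ]
  simpa using ha

theorem preservesNull_of_addEquiv (f : V ≃+ V) (hf : ∀ x, B (f x) (f x) = 0 ↔ B x x = 0) :
    PreservesNull B f.toEquiv := by
  intro x y
  rw [← hf (x - y)]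
  change B (f x - f y) (f x - f y) = 0 ↔ _
  rw [← map_sub]

/-- Three vectors that span a Lorentzian space with the standard scalar products. -/
structure LorentzTriple (B : LinearMap.BilinForm F V) (e₀ e₁ e₂ : V) : Prop where
  h00 : B e₀ e₀ = 1
  h11 : B e₁ e₁ = -1
  h22 : B e₂ e₂ = -1
  h01 : B e₀ e₁ = 0
  h02 : B e₀ e₂ = 0
  h12 : B e₁ e₂ = 0

theorem LorentzTriple.apply {e₀ e₁ e₂ : V} (he : LorentzTriple B e₀ e₁ e₂) (hB : B.IsSymm)
    (a b c a' b' c' : F) : B (a • e₀ + b • e₁ + c • e₂) (a' • e₀ + b' • e₁ + c' • e₂) =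
      a * a' - b * b' - c * c' := by
  have h10 : B e₁ e₀ = 0 := (hB.eq e₁ e₀).trans he.h01
  have h20 : B e₂ e₀ = 0 := (hB.eq e₂ e₀).trans he.h02
  have h21 : B e₂ e₁ = 0 := (hB.eq e₂ e₁).trans he.h12
  simp only [map_add, map_smul, LinearMap.add_apply, LinearMap.smul_apply, smul_eq_mul, he.h00,
    he.h11, he.h22, he.h01, he.h02, he.h12, h10, h20, h21]
  ring

variable [CharZero F]

/-- The left side equals `-2 * B a b`. Orthogonality of null vectors is thus expressed by the null
relation alone, and so survives a bijection that is not known to be linear. -/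
theorem apply_eq_zero_of_null_of_null_sub (hB : B.IsSymm) {a b : V} (ha : B a a = 0)
    (hb : B b b = 0) : B (a - b) (a - b) = 0 ↔ B a b = 0 := by
  have h : B (a - b) (a - b) = -2 * B a b := by
    simp only [map_sub, LinearMap.sub_apply, ha, hb, hB.eq b a]
    ring
  rw [h]
  simp

/-- The images of `p`, `p + a` and `p + t • a` are pairwise null related, so the two image
displacements are orthogonal null vectors, hence parallel: null lines go into null lines. -/
theorem PreservesNull.exists_smul (hB : B.IsSymm) (hpar : B.NullParallel) {φ : V ≃ V}
    (hφ : PreservesNull B φ) (p : V) {a : V} (ha0 : a ≠ 0) (ha : B a a = 0) (t : F) :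
    ∃ s : F, φ (p + t • a) - φ p = s • (φ (p + a) - φ p) := by
  have h1 : B (t • a) (t • a) = 0 := by simp [ha]
  refine hpar _ _ ?_ (hφ.null p ha) (hφ.null p h1) ?_
  · rw [sub_ne_zero]
    simpa using ha0
  · rw [← apply_eq_zero_of_null_of_null_sub hB (hφ.null p ha) (hφ.null p h1),
      sub_sub_sub_cancel_right, hφ]
    simp [ha]

theorem PreservesNull.exists_smul' (hB : B.IsSymm) (hpar : B.NullParallel) {φ : V ≃ V}
    (hφ : PreservesNull B φ) (p : V) {a : V} (ha0 : a ≠ 0) (ha : B a a = 0) (s : F) :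
    ∃ t : F, φ (p + t • a) - φ p = s • (φ (p + a) - φ p) := by
  obtain ⟨t, ht⟩ := hφ.symm.exists_smul hB hpar (φ p) (a := φ (p + a) - φ p)
    (by rw [sub_ne_zero]; simpa using ha0) (hφ.null p ha) s
  refine ⟨t, ?_⟩
  rw [add_sub_cancel, φ.symm_apply_apply, φ.symm_apply_apply, add_sub_cancel_left] at ht
  rw [← ht, add_sub_cancel, φ.apply_symm_apply, add_sub_cancel_left]

/-- Opposite sides of a parallelogram with null sides are mapped to orthogonal vectors. -/
theorem PreservesNull.apply_opposite_sides (hB : B.IsSymm) (hpar : B.NullParallel) {φ : V ≃ V}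
    (hφ : PreservesNull B φ) (p : V) {a b : V} (ha : B a a = 0) (hb : B b b = 0)
    (hab : B a b ≠ 0) :
    B (φ (p + a) - φ p) (φ (p + b + a) - φ (p + b)) = 0 := by
  have ha0 : a ≠ 0 := by rintro rfl; simp at hab
  by_contra hne
  -- Each point of one side line is null related to exactly one point of the opposite side line.
  have key : ∀ s t : F, B (φ (p + b + t • a) - φ (p + s • a)) (φ (p + b + t • a) - φ (p + s • a)) = 0
      ↔ t = s := by
    intro s t
    rw [hφ, show p + b + t • a - (p + s • a) = b + (t - s) • a by module]
    simp only [map_add, map_smul, LinearMap.add_apply, LinearMap.smul_apply, ha, hb, hB.eq b a,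
      smul_eq_mul]
    constructor
    · intro h
      have : 2 * ((t - s) * B a b) = 0 := by linear_combination h
      simpa [hab, sub_eq_zero] using this
    · rintro rfl
      ring
  have hc := hφ.null (p + b) ha
  set a' := φ (p + a) - φ p
  set c' := φ (p + b + a) - φ (p + b)
  set D := φ (p + b) - φ p
  -- If the image lines were not orthogonal, some point of the first would be joined to the second
  -- by a vector orthogonal to `c'`. Its square distance to the points of that line would be
  -- constant, against `key`.
  obtain ⟨s, hs⟩ := hφ.exists_smul' hB hpar p ha0 ha (B D c' / B a' c')
  have hconst : ∀ t : F, B (φ (p + b + t • a) - φ (p + s • a))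
      (φ (p + b + t • a) - φ (p + s • a)) =
      B (D - (B D c' / B a' c') • a') (D - (B D c' / B a' c') • a') := by
    intro t
    obtain ⟨r, hr⟩ := hφ.exists_smul hB hpar (p + b) ha0 ha t
    have : φ (p + b + t • a) - φ (p + s • a) = (D - (B D c' / B a' c') • a') + r • c' := by
      rw [← hs, ← hr]
      simp only [D]
      abel
    rw [this]
    have h0 : B (D - (B D c' / B a' c') • a') c' = 0 := by
      simp only [map_sub, map_smul, LinearMap.sub_apply, LinearMap.smul_apply, smul_eq_mul]
      field_simp
      ring
    generalize D - (B D c' / B a' c') • a' = E at *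
    simp [hB.eq c' E, h0, hc]
  have h1 := hconst (s + 1)
  rw [← hconst s, (key s s).2 rfl, key] at h1
  simp at h1

/-- Both pairs of opposite sides have parallel images. Since the image quadrilateral closes up,
pairing with one side forces the ratio of the other two to be 1. -/
theorem PreservesNull.parallelogram (hB : B.IsSymm) (hpar : B.NullParallel) {φ : V ≃ V}
    (hφ : PreservesNull B φ) (p : V) {a b : V} (ha : B a a = 0) (hb : B b b = 0)
    (hab : B a b ≠ 0) : φ (p + b + a) - φ (p + b) = φ (p + a) - φ p := by
  have ha0 : a ≠ 0 := by rintro rfl; simp at hab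
  have hb0 : b ≠ 0 := by rintro rfl; simp at hab
  obtain ⟨r, hr⟩ := hpar _ _ (by rw [sub_ne_zero]; simpa using ha0) (hφ.null p ha)
    (hφ.null (p + b) ha) (hφ.apply_opposite_sides hB hpar p ha hb hab)
  obtain ⟨s, hs⟩ := hpar _ _ (by rw [sub_ne_zero]; simpa using hb0) (hφ.null p hb)
    (hφ.null (p + a) hb)
    (hφ.apply_opposite_sides hB hpar p hb ha (by rwa [hB.eq]))
  have hab' : B (φ (p + a) - φ p) (φ (p + b) - φ p) ≠ 0 := by
    rw [Ne, ← apply_eq_zero_of_null_of_null_sub hB (hφ.null p ha) (hφ.null p hb),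
      sub_sub_sub_cancel_right, hφ, add_sub_add_left_eq_sub,
      apply_eq_zero_of_null_of_null_sub hB ha hb]
    exact hab
  have hsum : (φ (p + a) - φ p) + (φ (p + a + b) - φ (p + a)) =
      (φ (p + b) - φ p) + (φ (p + b + a) - φ (p + b)) := by
    rw [add_right_comm p a b]
    abel
  have h1 := congrArg (fun x => B x (φ (p + b) - φ p)) hsum
  rw [hr, hs] at h1
  simp only [map_add, map_smul, LinearMap.add_apply, LinearMap.smul_apply, hφ.null p hb,
    smul_eq_mul] at h1
  have : r = 1 := by
    apply mul_right_cancel₀ hab'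
    linear_combination -h1
  rw [hr, this, one_smul]

/-- The null vectors that are not orthogonal to a given nonzero null vector span the space. -/
def NullSpanning (B : LinearMap.BilinForm F V) : Prop :=
  ∀ a : V, a ≠ 0 → B a a = 0 → ⊤ ≤ Submodule.span F {b : V | B b b = 0 ∧ B a b ≠ 0}

/-- Moving the base point along a null vector not orthogonal to `a` changes nothing, by
`parallelogram`; such moves reach every point. -/
theorem PreservesNull.sub_eq_of_null (hB : B.IsSymm) (hpar : B.NullParallel)
    (hspan : B.NullSpanning) {φ : V ≃ V} (hφ : PreservesNull B φ) {a : V} (ha : B a a = 0)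
    (p : V) : φ (p + a) - φ p = φ a - φ 0 := by
  by_cases ha0 : a = 0
  · simp [ha0]
  have hp : ∀ q : V, φ (q + p + a) - φ (q + p) = φ (q + a) - φ q := by
    induction (hspan a ha0 ha (Submodule.mem_top (x := p))) using Submodule.closure_induction with
    | zero => simp
    | add x y _ _ hx hy =>
      intro q
      rw [← add_assoc, hy, hx]
    | smul_mem r b hb =>
      intro q
      obtain rfl | hr := eq_or_ne r 0
      · simp
      · exact hφ.parallelogram hB hpar q ha (by simp [hb.1]) (by simp [hb.2, hr])
  simpa using hp 0

/-- A bijection that preserves the null relation is additive up to a translation. -/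
theorem PreservesNull.sub_eq (hB : B.IsSymm) (hpar : B.NullParallel)
    (hspan : B.NullSpanning) {φ : V ≃ V} (hφ : PreservesNull B φ)
    (hnull : ∃ a : V, a ≠ 0 ∧ B a a = 0) (p x : V) : φ (p + x) - φ p = φ x - φ 0 := by
  obtain ⟨a, ha0, ha⟩ := hnull
  induction (hspan a ha0 ha (Submodule.mem_top (x := x))) using Submodule.closure_induction
    generalizing p with
  | zero => simp
  | add x y _ _ hx hy =>
    rw [← sub_add_sub_cancel _ (φ (p + x)), ← sub_add_sub_cancel (φ (x + y)) (φ x), ← hx p,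
      ← add_assoc, hy, hy]
  | smul_mem r b hb => exact hφ.sub_eq_of_null hB hpar hspan (by simp [hb.1]) p

/-- The additive part of a bijection that preserves the null relation. -/
def PreservesNull.toAddEquiv (hB : B.IsSymm) (hpar : B.NullParallel)
    (hspan : B.NullSpanning) {φ : V ≃ V} (hφ : PreservesNull B φ)
    (hnull : ∃ a : V, a ≠ 0 ∧ B a a = 0) : V ≃+ V where
  __ := φ.trans (Equiv.subRight (φ 0))
  map_add' x y := by
    have := hφ.sub_eq hB hpar hspan hnull x y
    change φ (x + y) - φ 0 = (φ x - φ 0) + (φ y - φ 0)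
    rw [← this]
    abel

/-! ### Additive bijections that preserve null vectors, on a Lorentzian triple. -/

/-- Three pairwise non-orthogonal null vectors are linearly independent. -/
theorem eq_zero_of_smul_add_smul_eq (hB : B.IsSymm) {x y z : V} (hx : B x x = 0)
    (hy : B y y = 0) (hz : B z z = 0) (hxy : B x y ≠ 0) (hxz : B x z ≠ 0) (hyz : B y z ≠ 0)
    {r s t : F} (h : r • x + s • y = t • z) : r = 0 ∧ s = 0 ∧ t = 0 := by
  have h1 := congrArg (B x) h
  have h2 := congrArg (B y) h
  have h3 := congrArg (B z) h
  have hyx : B y x = B x y := hB.eq y x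
  have hzx : B z x = B x z := hB.eq z x
  have hzy : B z y = B y z := hB.eq z y
  simp only [map_add, map_smul, smul_eq_mul, hx, hy, hz, hyx, hzx, hzy,
    mul_zero, zero_add, add_zero] at h1 h2 h3
  have h4 : 2 * (s * (B x y * B y z)) = 0 := by
    linear_combination B y z * h1 - B x z * h2 + B x y * h3
  have hs : s = 0 := by simpa [hxy, hyz] using h4
  subst hs
  have ht : t = 0 := by simpa [hxz] using h1.symm
  subst ht
  simpa [hxy] using h2

theorem apply_map_eq_zero_iff (hB : B.IsSymm) (f : V ≃+ V)
    (hf : ∀ x, B (f x) (f x) = 0 ↔ B x x = 0) {a b : V} (ha : B a a = 0) (hb : B b b = 0) :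
    B (f a) (f b) = 0 ↔ B a b = 0 := by
  rw [← apply_eq_zero_of_null_of_null_sub hB ((hf a).2 ha) ((hf b).2 hb), ← map_sub, hf,
    apply_eq_zero_of_null_of_null_sub hB ha hb]

theorem exists_smul_map (hB : B.IsSymm) (hpar : B.NullParallel) (f : V ≃+ V)
    (hf : ∀ x, B (f x) (f x) = 0 ↔ B x x = 0) {a : V} (ha0 : a ≠ 0) (ha : B a a = 0) (t : F) :
    ∃ s : F, f (t • a) = s • f a := by
  simpa using (preservesNull_of_addEquiv f hf).exists_smul hB hpar 0 ha0 ha t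

theorem exists_smul_map' (hB : B.IsSymm) (hpar : B.NullParallel) (f : V ≃+ V)
    (hf : ∀ x, B (f x) (f x) = 0 ↔ B x x = 0) {a : V} (ha0 : a ≠ 0) (ha : B a a = 0) (s : F) :
    ∃ t : F, f (t • a) = s • f a := by
  simpa using (preservesNull_of_addEquiv f hf).exists_smul' hB hpar 0 ha0 ha s

/-- An additive bijection that preserves null vectors is semilinear on the three vectors. -/
theorem LorentzTriple.exists_semilinear {e₀ e₁ e₂ : V} (he : LorentzTriple B e₀ e₁ e₂)
    (hB : B.IsSymm) (hpar : B.NullParallel) (f : V ≃+ V)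
    (hf : ∀ x, B (f x) (f x) = 0 ↔ B x x = 0) :
    ∃ σ : F → F, Function.Surjective σ ∧ ∀ t, f (t • e₀) = σ t • f e₀ ∧
      f (t • e₁) = σ t • f e₁ ∧ f (t • e₂) = σ t • f e₂ := by
  have h10 : B e₁ e₀ = 0 := (hB.eq e₁ e₀).trans he.h01
  have h20 : B e₂ e₀ = 0 := (hB.eq e₂ e₀).trans he.h02
  have h21 : B e₂ e₁ = 0 := (hB.eq e₂ e₁).trans he.h12
  have haa : B (e₀ + e₁) (e₀ + e₁) = 0 := by simp [he.h00, he.h11, he.h01, h10]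
  have hbb : B (e₀ - e₁) (e₀ - e₁) = 0 := by simp [he.h00, he.h11, he.h01, h10]
  have hcc : B (e₀ + e₂) (e₀ + e₂) = 0 := by simp [he.h00, he.h22, he.h02, h20]
  have hdd : B (e₀ - e₂) (e₀ - e₂) = 0 := by simp [he.h00, he.h22, he.h02, h20]
  have hab : B (e₀ + e₁) (e₀ - e₁) ≠ 0 := by norm_num [he.h00, he.h11, he.h01, h10]
  have hac : B (e₀ + e₁) (e₀ + e₂) ≠ 0 := by simp [he.h00, he.h12, he.h02, h10]
  have hbc : B (e₀ - e₁) (e₀ + e₂) ≠ 0 := by simp [he.h00, he.h12, he.h02, h10]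
  have had : B (e₀ + e₁) (e₀ - e₂) ≠ 0 := by simp [he.h00, he.h12, he.h02, h10]
  have ha0 : e₀ + e₁ ≠ 0 := by intro h; simp [h] at hab
  have hb0 : e₀ - e₁ ≠ 0 := by intro h; simp [h] at hab
  have hc0 : e₀ + e₂ ≠ 0 := by intro h; simp [h] at hac
  have hd0 : e₀ - e₂ ≠ 0 := by intro h; simp [h] at had
  choose σ hσ using exists_smul_map hB hpar f hf ha0 haa
  have hall : ∀ t, f (t • (e₀ - e₁)) = σ t • f (e₀ - e₁) ∧ f (t • (e₀ + e₂)) = σ t • f (e₀ + e₂) ∧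
      f (t • (e₀ - e₂)) = σ t • f (e₀ - e₂) := by
    intro t
    obtain ⟨β, hβ⟩ := exists_smul_map hB hpar f hf hb0 hbb t
    obtain ⟨γ, hγ⟩ := exists_smul_map hB hpar f hf hc0 hcc t
    obtain ⟨δ, hδ⟩ := exists_smul_map hB hpar f hf hd0 hdd t
    -- The four null directions satisfy one linear relation and three of them have independent
    -- images, so the four scaling factors agree.
    have hsum : f (e₀ + e₁) + f (e₀ - e₁) - f (e₀ + e₂) = f (e₀ - e₂) := by
      rw [← map_add, ← map_sub]
      congr 1
      abel
    have hsum' : f (t • (e₀ + e₁)) + f (t • (e₀ - e₁)) - f (t • (e₀ + e₂)) =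
        f (t • (e₀ - e₂)) := by
      rw [← map_add, ← map_sub]
      congr 1
      module
    rw [hσ, hβ, hγ, hδ, ← hsum] at hsum'
    have hlin : (σ t - δ) • f (e₀ + e₁) + (β - δ) • f (e₀ - e₁) = (γ - δ) • f (e₀ + e₂) := by
      linear_combination (norm := module) hsum'
    obtain ⟨h1, h2, h3⟩ := eq_zero_of_smul_add_smul_eq hB ((hf _).2 haa) ((hf _).2 hbb)
      ((hf _).2 hcc) (by rwa [Ne, apply_map_eq_zero_iff hB f hf haa hbb])
      (by rwa [Ne, apply_map_eq_zero_iff hB f hf haa hcc])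
      (by rwa [Ne, apply_map_eq_zero_iff hB f hf hbb hcc]) hlin
    rw [sub_eq_zero] at h1 h2 h3
    rw [hβ, hγ, hδ, h1, h2, h3]
    exact ⟨rfl, rfl, rfl⟩
  have hhalf : ∀ (t : F) (x y : V), f (t • x) = σ t • f x → f (t • y) = σ t • f y →
      ∀ z, x + y = z + z → f (t • z) = σ t • f z := by
    intro t x y hx hy z hz
    have h1 : f (t • z) + f (t • z) = σ t • (f z + f z) := by
      rw [← map_add, ← map_add, ← smul_add, ← hz, smul_add, map_add, hx, hy, map_add, smul_add]
    have h2 : (2 : F) • f (t • z) = (2 : F) • (σ t • f z) := by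
      linear_combination (norm := module) h1
    exact smul_right_injective V (two_ne_zero (α := F)) h2
  have hneg : ∀ (t : F) (x : V), f (t • x) = σ t • f x → f (t • (-x)) = σ t • f (-x) := by
    intro t x hx
    simp [hx]
  refine ⟨σ, ?_, fun t => ⟨hhalf t _ _ (hσ t) (hall t).1 _ (by abel),
    hhalf t _ _ (hσ t) (hneg t _ (hall t).1) _ (by abel),
    hhalf t _ _ (hall t).2.1 (hneg t _ (hall t).2.2) _ (by abel)⟩⟩
  intro s
  obtain ⟨t, ht⟩ := exists_smul_map' hB hpar f hf ha0 haa s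
  exact ⟨t, smul_left_injective F ((map_ne_zero_iff f f.injective).2 ha0) ((hσ t).symm.trans ht)⟩

/-- The images of the three vectors have, up to a factor, the standard scalar products. -/
theorem LorentzTriple.exists_apply_map {e₀ e₁ e₂ : V} (he : LorentzTriple B e₀ e₁ e₂)
    (hB : B.IsSymm) (f : V ≃+ V) (hf : ∀ x, B (f x) (f x) = 0 ↔ B x x = 0) :
    ∃ c : F, c ≠ 0 ∧ ∀ x y z : F, B (x • f e₀ + y • f e₁ + z • f e₂)
      (x • f e₀ + y • f e₁ + z • f e₂) = c * (x ^ 2 - y ^ 2 - z ^ 2) := by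
  have hnat : ∀ (x y z : ℤ), x ^ 2 - y ^ 2 - z ^ 2 = 0 →
      B (x • f e₀ + y • f e₁ + z • f e₂) (x • f e₀ + y • f e₁ + z • f e₂) = 0 := by
    intro x y z h
    rw [← map_zsmul, ← map_zsmul, ← map_zsmul, ← map_add, ← map_add, hf]
    have := he.apply hB x y z x y z
    simp only [Int.cast_smul_eq_zsmul] at this
    rw [this]
    have h' : ((x ^ 2 - y ^ 2 - z ^ 2 : ℤ) : F) = 0 := by rw [h]; simp
    push_cast at h'
    linear_combination h'
  have h10 : B (f e₁) (f e₀) = B (f e₀) (f e₁) := hB.eq _ _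
  have h20 : B (f e₂) (f e₀) = B (f e₀) (f e₂) := hB.eq _ _
  have h21 : B (f e₂) (f e₁) = B (f e₁) (f e₂) := hB.eq _ _
  have hv1 := hnat 1 1 0 (by norm_num)
  have hv2 := hnat 1 (-1) 0 (by norm_num)
  have hv3 := hnat 1 0 1 (by norm_num)
  have hv4 := hnat 1 0 (-1) (by norm_num)
  -- Additivity only handles integer coefficients. The Pythagorean triple is what reaches the mixed
  -- product of `f e₁` and `f e₂`.
  have hv5 := hnat 5 3 4 (by norm_num)
  simp only [← Int.cast_smul_eq_zsmul F, map_add, map_smul, LinearMap.add_apply,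
    LinearMap.smul_apply, smul_eq_mul, h10, h20, h21] at hv1 hv2 hv3 hv4 hv5
  push_cast at hv1 hv2 hv3 hv4 hv5
  have h11 : B (f e₁) (f e₁) = -B (f e₀) (f e₀) := by linear_combination (1 / 2) * (hv1 + hv2)
  have h22 : B (f e₂) (f e₂) = -B (f e₀) (f e₀) := by linear_combination (1 / 2) * (hv3 + hv4)
  have h01 : B (f e₀) (f e₁) = 0 := by linear_combination (1 / 4) * (hv1 - hv2)
  have h02 : B (f e₀) (f e₂) = 0 := by linear_combination (1 / 4) * (hv3 - hv4)
  have h12 : B (f e₁) (f e₂) = 0 := by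
    linear_combination (1 / 24) * hv5 - (5 / 4) * h01 - (5 / 3) * h02 - (3 / 8) * h11 -
      (2 / 3) * h22
  refine ⟨B (f e₀) (f e₀), ?_, fun x y z => ?_⟩
  · rw [Ne, hf, he.h00]
    exact one_ne_zero
  · simp only [map_add, map_smul, LinearMap.add_apply, LinearMap.smul_apply, smul_eq_mul, h10,
      h20, h21, h11, h22, h01, h02, h12]
    ring

/-- Semilinearity keeps the image of `e₀ + v • e₁` in the plane of `f e₀` and `f e₁`, to which `f
e₂` is orthogonal. -/
theorem LorentzTriple.apply_map_eq_zero {e₀ e₁ e₂ : V} (he : LorentzTriple B e₀ e₁ e₂)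
    (hB : B.IsSymm) (hpar : B.NullParallel) (f : V ≃+ V)
    (hf : ∀ x, B (f x) (f x) = 0 ↔ B x x = 0) (v : F) :
    B (f (e₀ + v • e₁)) (f e₂) = 0 := by
  obtain ⟨σ, -, hσ⟩ := he.exists_semilinear hB hpar f hf
  obtain ⟨c, -, hc⟩ := he.exists_apply_map hB f hf
  rw [map_add, (hσ v).2.1]
  have h1 := hc 1 (σ v) 1
  have h2 := hc 1 (σ v) (-1)
  rw [one_smul] at h1 h2
  generalize f e₀ + σ v • f e₁ = w at *
  have h3 : B (f e₂) w = B w (f e₂) := hB.eq _ _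
  simp only [map_add, map_smul, LinearMap.add_apply, LinearMap.smul_apply, smul_eq_mul, h3]
    at h1 h2
  linear_combination (1 / 4) * (h1 - h2)

/-- If an additive bijection preserves null vectors and the length of `e₂`, and it maps
`e₀ + v e₁` to a vector whose square length is a square, then `1 - v ^ 2` is a square. -/
theorem LorentzTriple.isSquare_one_sub_sq {e₀ e₁ e₂ : V} (he : LorentzTriple B e₀ e₁ e₂)
    (hB : B.IsSymm) (hpar : B.NullParallel) (f : V ≃+ V)
    (hf : ∀ x, B (f x) (f x) = 0 ↔ B x x = 0) {v τ : F}
    (hv : B (f (e₀ + v • e₁)) (f (e₀ + v • e₁)) = τ ^ 2) (h2 : B (f e₂) (f e₂) = -1) :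
    IsSquare (1 - v ^ 2) := by
  obtain ⟨σ, hσs, hσ⟩ := he.exists_semilinear hB hpar f hf
  obtain ⟨c, hc0, hc⟩ := he.exists_apply_map hB f hf
  have hsq : ∀ t, σ (t ^ 2) = σ t ^ 2 := by
    intro t
    -- The rational parametrisation of the cone: nullity of the image reads `4 σ(t²) = 4 σ(t)²`.
    have h0 : B ((1 + t ^ 2) • e₀ + (1 - t ^ 2) • e₁ + (2 * t) • e₂)
        ((1 + t ^ 2) • e₀ + (1 - t ^ 2) • e₁ + (2 * t) • e₂) = 0 := by
      rw [he.apply hB]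
      ring
    have h1 : f ((1 + t ^ 2) • e₀ + (1 - t ^ 2) • e₁ + (2 * t) • e₂) =
        (1 + σ (t ^ 2)) • f e₀ + (1 - σ (t ^ 2)) • f e₁ + (2 * σ t) • f e₂ := by
      simp only [add_smul, sub_smul, two_mul, one_smul, map_add, map_sub, (hσ _).1, (hσ _).2.1,
        (hσ _).2.2]
    rw [← hf, h1, hc] at h0
    have h3 := (mul_eq_zero.1 h0).resolve_left hc0
    linear_combination (1 / 4) * h3
  have hc1 : c = 1 := by
    have h3 := hc 0 0 1
    simp only [zero_smul, zero_add, one_smul, h2] at h3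
    linear_combination h3
  -- With `τ = σ t`, the length equation becomes `σ(t²) = 1 - σ(v²)`, which injectivity of `f` pulls
  -- back to `t² = 1 - v²`.
  obtain ⟨t, rfl⟩ := hσs τ
  have h4 := hc 1 (σ v) 0
  rw [one_smul, zero_smul, add_zero, ← (hσ v).2.1, ← map_add, hv, hc1, ← hsq, ← hsq] at h4
  have h5 : f ((t ^ 2) • e₀) = f ((1 - v ^ 2) • e₀) := by
    rw [sub_smul, one_smul, map_sub, (hσ _).1, (hσ _).1, h4]
    module
  have he0 : e₀ ≠ 0 := by
    rintro rfl
    simpa using he.h00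
  exact ⟨t, by rw [← sq]; exact (smul_left_injective F he0 (f.injective h5)).symm⟩

end NullVectors

/-! ### Points and their null cones. -/

section PointsAndNullCones

variable {F V : Type*} [Field F] [AddCommGroup V] [Module F V] {B : LinearMap.BilinForm F V}

theorem NullSpanning.exists_apply_ne_zero (hspan : B.NullSpanning) {a : V} (ha0 : a ≠ 0)
    (ha : B a a = 0) : ∃ b : V, B b b = 0 ∧ B a b ≠ 0 := by
  by_contra! h
  have h1 := hspan a ha0 ha (Submodule.mem_top (x := a))
  rw [show {b : V | B b b = 0 ∧ B a b ≠ 0} = ∅ from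
    Set.eq_empty_of_forall_notMem fun b hb => hb.2 (h b hb.1), Submodule.span_empty,
    Submodule.mem_bot] at h1
  exact ha0 h1

/-- A point is determined by its null cone. -/
theorem NullSpanning.eq_of_forall_null_iff [CharZero F] (hB : B.IsSymm) (hspan : B.NullSpanning)
    {x y : V} (h : ∀ z, B (z - x) (z - x) = 0 ↔ B (z - y) (z - y) = 0) : x = y := by
  by_contra hne
  have ha : B (y - x) (y - x) = 0 := by
    rw [h]
    simp
  obtain ⟨b, hb, hab⟩ := hspan.exists_apply_ne_zero (sub_ne_zero.2 (Ne.symm hne)) ha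
  have h1 := (h (x + b)).1 (by simpa using hb)
  rw [show x + b - y = b - (y - x) by abel, apply_eq_zero_of_null_of_null_sub hB hb ha,
    hB.eq] at h1
  exact hab h1

end PointsAndNullCones

end LinearMap.BilinForm

namespace Spacetime

/-! ### The Minkowski form over an ordered field. -/

section Minkowski

variable {d : ℕ} [NeZero d] {F : Type u} [Field F]

/-- The Minkowski form `x₀ y₀ - x₁ y₁ - ⋯`. -/
def minkowski (F : Type u) [Field F] (d : ℕ) [NeZero d] : LinearMap.BilinForm F (Fin d → F) :=
  LinearMap.mk₂ F (fun x y => x 0 * y 0 - ∑ i : Fin d with i ≠ 0, x i * y i)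
    (fun x y z => by simp only [Pi.add_apply, add_mul, Finset.sum_add_distrib]; ring)
    (fun c x y => by simp only [Pi.smul_apply, smul_eq_mul, mul_sub, Finset.mul_sum, mul_assoc])
    (fun x y z => by simp only [Pi.add_apply, mul_add, Finset.sum_add_distrib]; ring)
    (fun c x y => by
      simp only [Pi.smul_apply, smul_eq_mul, mul_sub, Finset.mul_sum, mul_left_comm])

theorem minkowski_apply (x y : Fin d → F) :
    minkowski F d x y = x 0 * y 0 - ∑ i : Fin d with i ≠ 0, x i * y i := rfl

theorem minkowski_sub_self (x y : Fin d → F) :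
    minkowski F d (x - y) (x - y) = time x y ^ 2 - space2 x y := by
  simp only [minkowski_apply, time, space2, Pi.sub_apply, sq]

theorem minkowski_isSymm : (minkowski F d).IsSymm :=
  ⟨fun x y => by simp only [minkowski_apply, mul_comm (x _)]⟩

theorem minkowski_single_zero (x : Fin d → F) (c : F) :
    minkowski F d x (Pi.single 0 c) = x 0 * c := by
  rw [minkowski_apply, Finset.sum_eq_zero, Pi.single_eq_same, sub_zero]
  intro i hi
  rw [Pi.single_eq_of_ne (Finset.mem_filter.1 hi).2, mul_zero]

theorem minkowski_single (x : Fin d → F) (c : F) {i : Fin d} (hi : i ≠ 0) :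
    minkowski F d x (Pi.single i c) = -(x i * c) := by
  rw [minkowski_apply, Finset.sum_eq_single i, Pi.single_eq_same, Pi.single_eq_of_ne hi.symm,
    mul_zero, zero_sub]
  · intro j _ hj
    rw [Pi.single_eq_of_ne hj, mul_zero]
  · simp [hi]

theorem minkowski_lorentzTriple {i j : Fin d} (hi : i ≠ 0) (hj : j ≠ 0) (hij : i ≠ j) :
    (minkowski F d).LorentzTriple (Pi.single 0 1) (Pi.single i 1) (Pi.single j 1) where
  h00 := by simp [minkowski_single_zero]
  h11 := by simp [minkowski_single _ _ hi]
  h22 := by simp [minkowski_single _ _ hj]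
  h01 := by simp [minkowski_single _ _ hi, hi]
  h02 := by simp [minkowski_single _ _ hj, hj]
  h12 := by simp [minkowski_single _ _ hj, hij.symm]

variable [LinearOrder F] [IsStrictOrderedRing F]

theorem eq_zero_of_minkowski_nonneg {x : Fin d → F} (hx : 0 ≤ minkowski F d x x)
    (h0 : x 0 = 0) : x = 0 := by
  rw [minkowski_apply, h0, mul_zero, zero_sub, Left.nonneg_neg_iff] at hx
  have hsum := (Finset.sum_eq_zero_iff_of_nonneg fun i _ => mul_self_nonneg (x i)).1
    (hx.antisymm (Finset.sum_nonneg fun i _ => mul_self_nonneg (x i)))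
  funext i
  by_cases hi : i = 0
  · rw [hi, h0, Pi.zero_apply]
  · simpa using hsum i (by simpa using hi)

/-- Subtracting the multiple of `a` with the same time component leaves a null vector of time
component 0, and the spatial part is definite. -/
theorem minkowski_nullParallel : (minkowski F d).NullParallel := by
  intro a b ha0 ha hb hab
  have h0 : a 0 ≠ 0 := fun h => ha0 (eq_zero_of_minkowski_nonneg ha.ge h)
  refine ⟨b 0 / a 0, sub_eq_zero.1 (eq_zero_of_minkowski_nonneg ?_ (by simp [h0]))⟩
  have hba : minkowski F d b a = 0 := (minkowski_isSymm.eq b a).trans hab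
  simp [ha, hb, hab, hba]

theorem minkowski_nullSpanning (hd : 3 ≤ d) : (minkowski F d).NullSpanning := by
  intro a ha0 ha
  have h0 : a 0 ≠ 0 := fun h => ha0 (eq_zero_of_minkowski_nonneg ha.ge h)
  set S := Submodule.span F {b : Fin d → F | minkowski F d b b = 0 ∧ minkowski F d a b ≠ 0}
  have hmem : ∀ (i : Fin d) (ε : F), i ≠ 0 → ε ^ 2 = 1 → a 0 - ε * a i ≠ 0 →
      Pi.single 0 1 + Pi.single i ε ∈ S := by
    intro i ε hi hε h
    refine Submodule.subset_span ⟨?_, ?_⟩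
    · rw [map_add, minkowski_single_zero, minkowski_single _ _ hi]
      simp only [Pi.add_apply, Pi.single_eq_same, Pi.single_eq_of_ne hi, Pi.single_eq_of_ne hi.symm]
      linear_combination -hε
    · rw [map_add, minkowski_single_zero, minkowski_single _ _ hi]
      rwa [mul_one, mul_comm, ← sub_eq_add_neg]
  have hmem' : ∀ (i : Fin d) (ε : F), i ≠ 0 → ε ^ 2 = 1 → Pi.single 0 1 + Pi.single i ε ∈ S := by
    intro i ε hi hε
    -- In the orthogonal case `a` has no component along a further direction `j`, so `e₀ ± e_j` and
    -- `e₀ - ε e_i` are admissible, and they combine to `e₀ + ε e_i`.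
    by_cases h : a 0 - ε * a i = 0
    · obtain ⟨j, hj0, hji⟩ := Fin.exists_ne_and_ne_of_two_lt 0 i hd
      have haj : a j = 0 := by
        have h1 : a i * a i + a j * a j ≤ ∑ i : Fin d with i ≠ 0, a i * a i := by
          rw [← Finset.sum_pair (f := fun k => a k * a k) hji.symm]
          refine Finset.sum_le_sum_of_subset_of_nonneg ?_ fun _ _ _ => mul_self_nonneg _
          intro k
          simp only [Finset.mem_insert, Finset.mem_singleton, Finset.mem_filter, Finset.mem_univ,
            true_and]
          rintro (rfl | rfl) <;> assumption
        rw [minkowski_apply] at ha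
        have h2 : a 0 * a 0 = a i * a i := by
          rw [sub_eq_zero.1 h]
          linear_combination a i ^ 2 * hε
        exact mul_self_eq_zero.1 (le_antisymm (by linarith) (mul_self_nonneg _))
      have h1 := hmem j 1 hj0 (by ring) (by simpa [haj] using h0)
      have h2 := hmem j (-1) hj0 (by ring) (by simpa [haj] using h0)
      have h3 := hmem i (-ε) hi (by rw [neg_sq, hε]) (by
        rw [show a 0 - -ε * a i = 2 * a 0 by linear_combination -h]
        simpa using h0)
      convert S.sub_mem (S.add_mem h1 h2) h3 using 1
      rw [Pi.single_neg, Pi.single_neg]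
      abel
    · exact hmem i ε hi hε h
  have hzero : (Pi.single 0 1 : Fin d → F) ∈ S := by
    obtain ⟨j, hj0, -⟩ := Fin.exists_ne_and_ne_of_two_lt 0 0 hd
    convert S.smul_mem (1 / 2) (S.add_mem (hmem' j 1 hj0 (by ring)) (hmem' j (-1) hj0 (by ring)))
      using 1
    rw [Pi.single_neg]
    module
  intro x _
  rw [pi_eq_sum_univ' x]
  refine S.sum_mem fun i _ => S.smul_mem _ ?_
  by_cases hi : i = 0
  · rwa [hi]
  · convert S.sub_mem (hmem' i 1 hi (by ring)) hzero using 1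
    abel

theorem exists_minkowski_null (hd : 3 ≤ d) :
    ∃ a : Fin d → F, a ≠ 0 ∧ minkowski F d a a = 0 := by
  obtain ⟨j, hj0, -⟩ := Fin.exists_ne_and_ne_of_two_lt 0 0 hd
  refine ⟨Pi.single 0 1 + Pi.single j 1, fun h => ?_, ?_⟩
  · simpa [hj0.symm] using congrFun h 0
  · simp [minkowski_single_zero, minkowski_single _ _ hj0, hj0, hj0.symm]

end Minkowski

open LinearMap.BilinForm

theorem space2_zero_ite {d : ℕ} [NeZero d] {F : Type u} [Field F] (hd : 3 ≤ d) :
    space2 (fun _ : Fin d => (0 : F)) (fun i => if i.val < 2 then 1 else 0) = 1 := by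
  rw [space2, Finset.sum_eq_single (⟨1, by omega⟩ : Fin d)]
  · simp
  · intro i hi hi1
    have h0 : i.val ≠ 0 := fun h => (Finset.mem_filter.1 hi).2 (Fin.ext (by simpa using h))
    have h1 : i.val ≠ 1 := fun h => hi1 (Fin.ext h)
    rw [if_neg (by omega)]
    simp
  · intro h
    exact absurd (Finset.mem_filter.2
      ⟨Finset.mem_univ _, fun h => by simpa using congrArg Fin.val h⟩) h

/-! ### Worldview transformations, and square roots from moving observers. -/

namespace Model

variable {d : ℕ} [NeZero d] (M : Model.{u} d)

theorem SpeedOfLight.sq_eq_one [M.AxOField] (hd : 3 ≤ d) {m : M.B}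
    (hph : ∃ p, M.Ph p ∧ M.W m p (fun _ => 0) ∧ M.W m p (fun i => if i.val < 2 then 1 else 0))
    {c : M.Q} (hc : M.SpeedOfLight m c) : c ^ 2 = 1 := by
  have h := hc.2 _ _ hph
  rw [space2_zero_ite hd, time] at h
  simpa using h.symm

theorem SpecRel.exists_photon_iff [h : M.SpecRel] (hd : 3 ≤ d) {m : M.B} (hm : M.IOb m)
    (x y : Fin d → M.Q) : (∃ p, M.Ph p ∧ M.W m p x ∧ M.W m p y) ↔
      minkowski M.Q d (x - y) (x - y) = 0 := by
  obtain ⟨c, hc, hxy⟩ := h.axPh m hm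
  have h1 : c ^ 2 = 1 :=
    SpeedOfLight.sq_eq_one M hd (h.axSymD.2 m hm) ⟨hc, fun x y => (hxy x y).1⟩
  rw [hxy, h1, one_mul, minkowski_sub_self, sub_eq_zero, eq_comm]

theorem SpecRel.speedOfLight_one [h : M.SpecRel] (hd : 3 ≤ d) {m : M.B} (hm : M.IOb m) :
    M.SpeedOfLight m 1 := by
  refine ⟨zero_lt_one, fun x y hxy => ?_⟩
  rw [exists_photon_iff M hd hm, minkowski_sub_self, sub_eq_zero] at hxy
  rw [one_pow, one_mul, hxy]

theorem SpecRel.null_iff_of_ev_eq [h : M.SpecRel] (hd : 3 ≤ d) {m k : M.B} (hm : M.IOb m)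
    (hk : M.IOb k) {x y x' y' : Fin d → M.Q} (hx : M.ev m x = M.ev k x')
    (hy : M.ev m y = M.ev k y') : minkowski M.Q d (x' - y') (x' - y') = 0 ↔
      minkowski M.Q d (x - y) (x - y) = 0 := by
  rw [← exists_photon_iff M hd hm x y, ← exists_photon_iff M hd hk x' y']
  have hx' : ∀ b, M.W m b x ↔ M.W k b x' := fun b => Set.ext_iff.1 hx b
  have hy' : ∀ b, M.W m b y ↔ M.W k b y' := fun b => Set.ext_iff.1 hy b
  simp only [hx', hy']

/-- Points with the same event are joined by photons to the same points, so they have the same null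
cone. -/
theorem SpecRel.ev_injective [h : M.SpecRel] (hd : 3 ≤ d) {m : M.B} (hm : M.IOb m) :
    Function.Injective (M.ev m) := fun _ _ hxy =>
  (minkowski_nullSpanning hd).eq_of_forall_null_iff minkowski_isSymm fun _ =>
    (null_iff_of_ev_eq M hd hm hm rfl hxy).symm

/-- The worldview transformation between two inertial observers. -/
theorem SpecRel.exists_worldview_equiv [h : M.SpecRel] (hd : 3 ≤ d) {m k : M.B} (hm : M.IOb m)
    (hk : M.IOb k) : ∃ φ : (Fin d → M.Q) ≃ (Fin d → M.Q), ∀ x, M.ev m x = M.ev k (φ x) := by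
  choose f hf using h.axEv m k hm hk
  choose g hg using h.axEv k m hk hm
  exact ⟨⟨f, g, fun x => ev_injective M hd hm (by rw [← hg, ← hf]),
    fun x => ev_injective M hd hk (by rw [← hf, ← hg])⟩, hf⟩

/-- An inertial observer that moves with velocity `v` exists only if `1 - v ^ 2` is a square. -/
theorem SpecRel.isSquare_one_sub_sq [h : M.SpecRel] (hd : 3 ≤ d) {m k : M.B} (hm : M.IOb m)
    (hk : M.IOb k) {i : Fin d} (hi : i ≠ 0) {v : M.Q} (h0 : M.W m k 0)
    (hv : M.W m k (Pi.single 0 1 + v • Pi.single i 1)) : IsSquare (1 - v ^ 2) := by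
  obtain ⟨φ, hφ⟩ := exists_worldview_equiv M hd hm hk
  have hpres : (minkowski M.Q d).PreservesNull φ := fun x y =>
    null_iff_of_ev_eq M hd hm hk (hφ x) (hφ y)
  have hB := minkowski_isSymm (d := d) (F := M.Q)
  have hpar := minkowski_nullParallel (d := d) (F := M.Q)
  set f := hpres.toAddEquiv hB hpar (minkowski_nullSpanning hd) (exists_minkowski_null hd)
  have hf : ∀ x, f x = φ x - φ 0 := fun x => rfl
  have hnull : ∀ x, minkowski M.Q d (f x) (f x) = 0 ↔ minkowski M.Q d x x = 0 := by
    intro x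
    rw [hf, hpres, sub_zero]
  -- A direction transverse to the motion, along which the two observers can compare lengths.
  obtain ⟨j, hj, hji⟩ := Fin.exists_ne_and_ne_of_two_lt 0 i hd
  have he := minkowski_lorentzTriple (F := M.Q) hi hj hji.symm
  set u : Fin d → M.Q := Pi.single 0 1 + v • Pi.single i 1
  have haxis : ∀ x, M.W m k x → ∀ l, l ≠ 0 → φ x l = 0 := fun x hx =>
    (h.axSelf k hk _).1 ((Set.ext_iff.1 (hφ x) k).1 hx)
  have hu : f u = Pi.single 0 (f u 0) := by
    funext l
    by_cases hl : l = 0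
    · rw [hl, Pi.single_eq_same]
    · rw [Pi.single_eq_of_ne hl, hf, Pi.sub_apply, haxis _ hv l hl, haxis _ h0 l hl, sub_zero]
  have hu0 : f u 0 ≠ 0 := by
    intro h1
    rw [h1, Pi.single_zero, map_eq_zero_iff f f.injective] at hu
    simpa [u, hi.symm] using congrFun hu 0
  -- The image of the transverse unit vector is orthogonal to the time axis of `k`, so its endpoints
  -- are simultaneous for `k` as well and `AxSymD` applies.
  have hperp := he.apply_map_eq_zero hB hpar f hnull v
  rw [hB.eq, hu, minkowski_single_zero] at hperp
  have hsim : f (Pi.single j 1) 0 = 0 := (mul_eq_zero.1 hperp).resolve_right hu0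
  refine he.isSquare_one_sub_sq hB hpar f hnull (v := v) (τ := f u 0) ?_ ?_
  · change minkowski M.Q d (f u) (f u) = _
    conv_lhs => rw [hu]
    rw [minkowski_single_zero, Pi.single_eq_same, sq]
  · have hsp := h.axSymD.1 m k hm hk (Pi.single j 1) 0 _ _ (by simp [hj.symm])
      (by rwa [hf, Pi.sub_apply, sub_eq_zero] at hsim) (hφ _) (hφ _)
    have h1 := minkowski_sub_self (φ (Pi.single j 1)) (φ 0)
    have h2 := minkowski_sub_self (Pi.single j (1 : M.Q)) 0
    have h3 : time (φ (Pi.single j 1)) (φ 0) = 0 := by rwa [hf] at hsim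
    have h4 : time (Pi.single j (1 : M.Q)) 0 = 0 := by simp [time, hj.symm]
    rw [sub_zero, minkowski_single _ _ hj, Pi.single_eq_same] at h2
    rw [hf, h1, h3, ← hsp]
    rw [h4] at h2
    linear_combination -h2

theorem SpecRelThExp.isEuclideanField [h : M.SpecRelThExp] (hd : 3 ≤ d) :
    IsEuclideanField M.Q where
  exists_sqrt a ha := by
    obtain ⟨⟨m, hm⟩, hexp⟩ := h.axThExp
    obtain ⟨i, hi, -⟩ := Fin.exists_ne_and_ne_of_two_lt (0 : Fin d) 0 hd
    have ha1 : a + 1 ≠ 0 := by positivity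
    -- Chosen so that `1 - v ^ 2` is `a` times a nonzero square.
    set v := (a - 1) / (a + 1)
    have hv : 1 - v ^ 2 = a * (2 / (a + 1)) ^ 2 := by
      simp only [v]
      field_simp
      ring
    have hmu : minkowski M.Q d (0 - (Pi.single 0 1 + v • Pi.single i 1))
        (0 - (Pi.single 0 1 + v • Pi.single i 1)) = 1 - v ^ 2 := by
      have hsmul : v • (Pi.single i 1 : Fin d → M.Q) = Pi.single i v := by
        rw [← Pi.single_smul, smul_eq_mul, mul_one]
      rw [zero_sub, LinearMap.BilinForm.neg_left, LinearMap.BilinForm.neg_right, neg_neg,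
        hsmul, map_add, minkowski_single_zero, minkowski_single _ _ hi]
      simp only [Pi.add_apply, Pi.single_eq_same, Pi.single_eq_of_ne hi, Pi.single_eq_of_ne hi.symm]
      ring
    obtain ⟨k, hk, h0, h1⟩ := hexp m hm 1 (SpecRel.speedOfLight_one M hd hm) 0
      (Pi.single 0 1 + v • Pi.single i 1) (by
        rw [one_pow, one_mul, ← sub_pos, ← minkowski_sub_self, hmu, hv]
        positivity)
    obtain ⟨t, ht⟩ := SpecRel.isSquare_one_sub_sq M hd hm hk hi h0 h1
    refine ⟨t / (2 / (a + 1)), ?_⟩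
    rw [div_mul_div_comm, ← ht, hv]
    field_simp

end Model

/-! ### Reflections and Poincaré maps. -/

section Reflection

variable {F V : Type*} [Field F] [AddCommGroup V] [Module F V]

/-- The reflection in the direction of `r`; it is the identity if `r` is a null vector. -/
def reflect (B : LinearMap.BilinForm F V) (r x : V) : V := x - (2 * B x r / B r r) • r

theorem reflect_sub (B : LinearMap.BilinForm F V) (r x y : V) :
    reflect B r x - reflect B r y = reflect B r (x - y) := by
  simp only [reflect, map_sub, LinearMap.sub_apply, mul_sub, sub_div]
  module

theorem reflect_smul (B : LinearMap.BilinForm F V) (r : V) (c : F) (x : V) :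
    reflect B r (c • x) = c • reflect B r x := by
  simp only [reflect, map_smul, LinearMap.smul_apply, smul_eq_mul, smul_sub, smul_smul]
  congr 2
  ring

theorem apply_reflect {B : LinearMap.BilinForm F V} (hB : B.IsSymm) (r x : V) :
    B (reflect B r x) (reflect B r x) = B x x := by
  have h : B r x = B x r := hB.eq r x
  by_cases hr : B r r = 0
  · simp [reflect, hr]
  · simp only [reflect, map_sub, map_smul, LinearMap.sub_apply, LinearMap.smul_apply, smul_eq_mul,
      h]
    field_simp
    ring

theorem reflect_reflect (B : LinearMap.BilinForm F V) (r x : V) :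
    reflect B r (reflect B r x) = x := by
  by_cases hr : B r r = 0
  · simp [reflect, hr]
  · have h : 2 * B (reflect B r x) r / B r r = -(2 * B x r / B r r) := by
      simp only [reflect, map_sub, map_smul, LinearMap.sub_apply, LinearMap.smul_apply,
        smul_eq_mul]
      field_simp
      ring
    rw [reflect, h, reflect]
    module

/-- The reflection that exchanges two vectors of the same length. -/
theorem reflect_sub_apply [CharZero F] {B : LinearMap.BilinForm F V} (hB : B.IsSymm) {x y : V}
    (hxy : B x x = B y y) (hne : B (y - x) (y - x) ≠ 0) : reflect B (y - x) x = y := by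
  have h : B y x = B x y := hB.eq y x
  have h1 : 2 * B x (y - x) = -B (y - x) (y - x) := by
    simp only [map_sub, LinearMap.sub_apply, h, ← hxy]
    ring
  rw [reflect, h1, neg_div, div_self hne]
  module

end Reflection

section PoincareMap

variable {d : ℕ} [NeZero d] {F : Type u} [Field F]

/-- A bijection that preserves the Minkowski distance. -/
abbrev PoincareMap (F : Type u) [Field F] (d : ℕ) [NeZero d] : Type u :=
  {T : (Fin d → F) ≃ (Fin d → F) //
    ∀ x y, minkowski F d (T x - T y) (T x - T y) = minkowski F d (x - y) (x - y)}

/-- A line in the direction of a nonzero null vector. -/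
structure LightLine (F : Type u) [Field F] (d : ℕ) [NeZero d] : Type u where
  point : Fin d → F
  direction : Fin d → F
  direction_ne_zero : direction ≠ 0
  null : minkowski F d direction direction = 0

/-- The points of a light line. -/
def LightLine.points (l : LightLine F d) : Set (Fin d → F) :=
  {z | ∃ t : F, z = l.point + t • l.direction}

/-- The image of the time axis. -/
def PoincareMap.worldline (T : PoincareMap F d) : Set (Fin d → F) :=
  {z | ∀ i, i ≠ 0 → T.1.symm z i = 0}

theorem LightLine.exists_mem_iff (hnull : ∃ a : Fin d → F, a ≠ 0 ∧ minkowski F d a a = 0)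
    (x y : Fin d → F) : (∃ l : LightLine F d, x ∈ l.points ∧ y ∈ l.points) ↔
      minkowski F d (x - y) (x - y) = 0 := by
  constructor
  · rintro ⟨l, ⟨s, rfl⟩, ⟨t, rfl⟩⟩
    rw [add_sub_add_left_eq_sub, ← sub_smul]
    simp [l.null]
  · intro h
    by_cases hxy : x = y
    · obtain ⟨a, ha0, ha⟩ := hnull
      exact ⟨⟨x, a, ha0, ha⟩, ⟨0, by simp⟩, ⟨0, by simp [hxy]⟩⟩
    · exact ⟨⟨y, x - y, sub_ne_zero.2 hxy, h⟩, ⟨1, by simp⟩, ⟨0, by simp⟩⟩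

variable [LinearOrder F] [IsStrictOrderedRing F]

/-- Every vector of square length `1` is the image of the time unit vector under a reflection. -/
theorem exists_reflect_eq {w : Fin d → F} (hw : minkowski F d w w = 1) :
    ∃ r, reflect (minkowski F d) r (Pi.single 0 1) = w := by
  refine ⟨w - Pi.single 0 1, ?_⟩
  have h0 : minkowski F d (Pi.single 0 1) (Pi.single 0 1) = 1 := by simp [minkowski_single_zero]
  have hr : minkowski F d (w - Pi.single 0 1) (w - Pi.single 0 1) = 2 * (1 - w 0) := by
    have h1 : minkowski F d (Pi.single 0 1) w = minkowski F d w (Pi.single 0 1) :=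
      minkowski_isSymm.eq _ _
    simp only [LinearMap.BilinForm.sub_left, LinearMap.BilinForm.sub_right, h0, hw, h1,
      minkowski_single_zero]
    ring
  -- By `hr` this is the only case where the reflecting vector is null; then it is 0 and `reflect`
  -- is the identity.
  by_cases hne : w 0 = 1
  · have : w - Pi.single 0 1 = 0 :=
      eq_zero_of_minkowski_nonneg (by rw [hr, hne]; simp) (by simp [hne])
    rw [this, reflect, ← sub_eq_zero, ← neg_eq_zero]
    simpa using this
  · refine reflect_sub_apply minkowski_isSymm (h0.trans hw.symm) ?_
    rw [hr]
    simpa [sub_eq_zero] using fun h => hne h.symm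

/-- In a Euclidean field two timelike separated points lie on the worldline of an observer. -/
theorem PoincareMap.exists_mem_worldline (hsqrt : ∀ a : F, 0 < a → ∃ b, b * b = a)
    {x y : Fin d → F} (h : 0 < minkowski F d (x - y) (x - y)) :
    ∃ T : PoincareMap F d, x ∈ T.worldline ∧ y ∈ T.worldline := by
  obtain ⟨s, hs⟩ := hsqrt _ h
  have hs0 : s ≠ 0 := by
    rintro rfl
    rw [← hs, mul_zero] at h
    exact h.false
  obtain ⟨r, hr⟩ := exists_reflect_eq (w := s⁻¹ • (x - y)) (by
    rw [LinearMap.BilinForm.smul_left, LinearMap.BilinForm.smul_right, ← hs]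
    field_simp)
  have hinv : reflect (minkowski F d) r (x - y) = s • Pi.single 0 1 := by
    rw [← reflect_reflect (minkowski F d) r (Pi.single 0 1), hr, ← reflect_smul,
      smul_inv_smul₀ hs0]
  let R : (Fin d → F) ≃ (Fin d → F) :=
    ⟨reflect (minkowski F d) r, reflect (minkowski F d) r, reflect_reflect _ r, reflect_reflect _ r⟩
  let T : PoincareMap F d := ⟨R.trans (Equiv.addRight y), fun a b => by
    change minkowski F d ((reflect _ r a + y) - (reflect _ r b + y))
      ((reflect _ r a + y) - (reflect _ r b + y)) = _
    rw [add_sub_add_right_eq_sub, reflect_sub, apply_reflect minkowski_isSymm]⟩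
  have hT : ∀ z, T.1.symm z = reflect (minkowski F d) r (z - y) := fun z => by
    rw [sub_eq_add_neg]
    rfl
  refine ⟨T, fun i hi => ?_, fun i hi => ?_⟩
  · rw [hT, hinv]
    simp [hi]
  · rw [hT, sub_self, reflect]
    simp

end PoincareMap

/-! ### The Poincaré model satisfies the axioms. -/

/-- The model over an ordered field whose inertial observers are the Poincaré maps and whose light
signals are the light lines. The observer `T` sees at `x` the bodies that pass through `T x`. -/
noncomputable def poincareModel (d : ℕ) [NeZero d] (A : QuantityStructure.{u}) [IsOrderedField A] :
    Model.{u} d where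
  Q := A
  B := PoincareMap A d ⊕ LightLine A d
  nonempty_bodies := ⟨Sum.inl ⟨Equiv.refl _, fun _ _ => rfl⟩⟩
  Ob b := b.isLeft
  IOb b := b.isLeft
  Ph b := b.isRight
  W m b x := ∃ T, m = Sum.inl T ∧ T.1 x ∈ b.elim PoincareMap.worldline LightLine.points

namespace poincareModel

variable {d : ℕ} [NeZero d] {A : QuantityStructure.{u}} [IsOrderedField A]

theorem W_inl (T : PoincareMap A d) (b : PoincareMap A d ⊕ LightLine A d) (x : Fin d → A) :
    (poincareModel d A).W (Sum.inl T) b x ↔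
      T.1 x ∈ b.elim PoincareMap.worldline LightLine.points := by
  constructor
  · rintro ⟨S, hS, h⟩
    rwa [Sum.inl_injective hS]
  · exact fun h => ⟨T, rfl, h⟩

theorem exists_inl {m : (poincareModel d A).B} (hm : (poincareModel d A).IOb m) :
    ∃ T : PoincareMap A d, m = Sum.inl T := Sum.isLeft_iff.1 hm

theorem exists_photon_iff (hd : 3 ≤ d) (T : PoincareMap A d) (x y : Fin d → A) :
    (∃ p, (poincareModel d A).Ph p ∧ (poincareModel d A).W (Sum.inl T) p x ∧
      (poincareModel d A).W (Sum.inl T) p y) ↔ space2 x y = time x y ^ 2 := by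
  rw [eq_comm, ← sub_eq_zero, ← minkowski_sub_self, ← T.2,
    ← LightLine.exists_mem_iff (exists_minkowski_null hd)]
  constructor
  · rintro ⟨p, hp, hx, hy⟩
    obtain ⟨l, rfl⟩ := Sum.isRight_iff.1 hp
    exact ⟨l, (W_inl T _ x).1 hx, (W_inl T _ y).1 hy⟩
  · rintro ⟨l, hx, hy⟩
    exact ⟨Sum.inr l, rfl, (W_inl T _ x).2 hx, (W_inl T _ y).2 hy⟩

theorem W_self (T : PoincareMap A d) (x : Fin d → A) :
    (poincareModel d A).W (Sum.inl T) (Sum.inl T) x ↔ ∀ i, i ≠ 0 → x i = 0 := by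
  refine (W_inl T _ x).trans (forall₂_congr fun i _ => ?_)
  rw [Equiv.symm_apply_apply T.1]

/-- An event determines the point at which it occurs. -/
theorem apply_eq_of_ev_eq (hd : 3 ≤ d) (T S : PoincareMap A d) {x y : Fin d → A}
    (h : (poincareModel d A).ev (Sum.inl T) x = (poincareModel d A).ev (Sum.inl S) y) :
    T.1 x = S.1 y := by
  refine (minkowski_nullSpanning hd).eq_of_forall_null_iff minkowski_isSymm fun z => ?_
  rw [← LightLine.exists_mem_iff (exists_minkowski_null hd),
    ← LightLine.exists_mem_iff (exists_minkowski_null hd)]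
  refine exists_congr fun l => and_congr_right fun _ => ?_
  exact ((W_inl T (Sum.inr l) x).symm.trans (Set.ext_iff.1 h (Sum.inr l))).trans
    (W_inl S (Sum.inr l) y)

/-- Minkowski distance is common to all observers, and for simultaneous points it is minus the
squared spatial distance. -/
theorem space2_eq_of_ev_eq (hd : 3 ≤ d) (T S : PoincareMap A d) {x y x' y' : Fin d → A}
    (h0 : x 0 = y 0) (h0' : x' 0 = y' 0)
    (hx : (poincareModel d A).ev (Sum.inl T) x = (poincareModel d A).ev (Sum.inl S) x')
    (hy : (poincareModel d A).ev (Sum.inl T) y = (poincareModel d A).ev (Sum.inl S) y') :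
    space2 x y = space2 x' y' := by
  have h := T.2 x y
  rw [apply_eq_of_ev_eq hd T S hx, apply_eq_of_ev_eq hd T S hy, S.2, minkowski_sub_self,
    minkowski_sub_self, time, time, h0, h0'] at h
  linear_combination h

instance : (poincareModel d A).AxOField := inferInstanceAs (IsOrderedField A)

theorem axSymD (hd : 3 ≤ d) : (poincareModel d A).AxSymD := by
  refine ⟨fun m k hm hk x y x' y' h0 h0' hx hy => ?_, fun m hm => ?_⟩
  · obtain ⟨T, rfl⟩ := exists_inl hm
    obtain ⟨S, rfl⟩ := exists_inl hk
    exact space2_eq_of_ev_eq hd T S h0 h0' hx hy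
  · obtain ⟨T, rfl⟩ := exists_inl hm
    refine (exists_photon_iff hd T (fun _ => 0) (fun i => if i.val < 2 then 1 else 0)).2 ?_
    rw [space2_zero_ite hd, time]
    simp

theorem specRel (hd : 3 ≤ d) : (poincareModel d A).SpecRel where
  axPh := by
    intro m hm
    obtain ⟨T, rfl⟩ := exists_inl hm
    have h : ∀ x y : Fin d → A, (∃ p, (poincareModel d A).Ph p ∧
        (poincareModel d A).W (Sum.inl T) p x ∧ (poincareModel d A).W (Sum.inl T) p y) ↔
        space2 x y = 1 ^ 2 * time x y ^ 2 := by
      intro x y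
      rw [exists_photon_iff hd, one_pow, one_mul]
    exact ⟨(1 : A), zero_lt_one (α := A), h⟩
  axEv := by
    intro m k hm hk x
    obtain ⟨T, rfl⟩ := exists_inl hm
    obtain ⟨S, rfl⟩ := exists_inl hk
    refine ⟨S.1.symm (T.1 x), Set.ext fun b => (W_inl T b x).trans ((W_inl S b _).trans ?_).symm⟩
    rw [Equiv.apply_symm_apply S.1]
  axSelf := by
    intro m hm x
    obtain ⟨T, rfl⟩ := exists_inl hm
    exact W_self T x
  axSymD := axSymD hd

theorem specRelThExp (hd : 3 ≤ d) (hA : IsEuclideanField A) :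
    (poincareModel d A).SpecRelThExp where
  toSpecRel := specRel hd
  axThExp := by
    refine ⟨⟨Sum.inl ⟨Equiv.refl _, fun _ _ => rfl⟩, rfl⟩, fun m hm c hc x y hxy => ?_⟩
    rw [Model.SpeedOfLight.sq_eq_one _ hd ((axSymD hd).2 m hm) hc, one_mul] at hxy
    obtain ⟨T, rfl⟩ := exists_inl hm
    have h : 0 < minkowski A d (T.1 x - T.1 y) (T.1 x - T.1 y) :=
      ((sub_pos (α := A)).2 hxy).trans_eq
        ((minkowski_sub_self (F := A) x y).symm.trans (T.2 x y).symm)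
    obtain ⟨S, hx, hy⟩ := PoincareMap.exists_mem_worldline hA.exists_sqrt h
    exact ⟨Sum.inl S, rfl, (W_inl T _ x).2 hx, (W_inl T _ y).2 hy⟩

end poincareModel

end Spacetime

theorem theorem3p6 (n : ℕ) [NeZero n] (hn : 3 ≤ n) :
    Spacetime.Num.{u} n (fun M => M.SpecRelThExp) =
      {A : Spacetime.QuantityStructure.{u} | Spacetime.IsEuclideanField A} := by
  ext A
  constructor
  · rintro ⟨M, hM, rfl⟩
    exact Spacetime.Model.SpecRelThExp.isEuclideanField M hn
  · intro hA
    have : Spacetime.IsEuclideanField A := hA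
    exact ⟨Spacetime.poincareModel n A, Spacetime.poincareModel.specRelThExp hn hA, rfl⟩
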